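/- Let $L/K$ be a finite separable extension of fields. A Hopf–Galois structure on $L/K$ consists of a $K$-Hopf algebra $H$ together with a ($K$-linear) left $H$-module structure on $L$ such that $h\cdot 1=\varepsilon(h)1$ and $h\cdot(ab)=\sum (h_{(1)}\cdot a)(h_{(2)}\cdot b)$ for all $h\in H$ and $a,b\in L$ (where $\varepsilon$ is the counit and $\Delta(h)=\sum h_{(1)}\otimes h_{(2)}$ the comultiplication), and such that the $K$-linear map $L\otimes_K H\to \operatorname{End}_K(L)$, $s\otimes h\mapsto (t\mapsto s\,(h\cdot t))$, is bijective. (Such an $H$ is automatically cocommutative and of dimension $[L:K]$ over $K$.) Let $H_1,H_2$ be two Hopf algebras giving Hopf–Galois structures on $L/K$ whose actions commute, that is, $h_1\cdot(h_2\cdot y)=h_2\cdot(h_1\cdot y)$ for all $h_1\in H_1$, $h_2\in H_2$, $y\in L$. Then an element $x\in L$ generates $L$ as an $H_1$-module if and only if it generates $L$ as an $H_2$-module. -/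

import Mathlib

open scoped TensorProduct

namespace HopfGalois

variable (K H L : Type*) [Field K] [Ring H] [HopfAlgebra K H] [Field L] [Algebra K L]
  [Module H L] [IsScalarTower K H L]

/-- For `a b : L`, the `K`-linear map `H ⊗[K] H → L` with `h ⊗ k ↦ (h • a) * (k • b)`. -/
noncomputable def smulMulSmul (a b : L) : H ⊗[K] H →ₗ[K] L :=
  TensorProduct.lift
    ((LinearMap.mul K L).compl₁₂
      ((Algebra.lsmul K K L : H →ₐ[K] Module.End K L).toLinearMap.flip a)
      ((Algebra.lsmul K K L : H →ₐ[K] Module.End K L).toLinearMap.flip b))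

@[simp]
theorem smulMulSmul_tmul (a b : L) (h k : H) :
    smulMulSmul K H L a b (h ⊗ₜ[K] k) = (h • a) * (k • b) := by
  simp [smulMulSmul]

/-- The canonical `K`-linear map `j : L ⊗[K] H → End_K(L)`, `j (s ⊗ h) (t) = s * (h • t)`. -/
noncomputable def canonicalMap : L ⊗[K] H →ₗ[K] Module.End K L :=
  TensorProduct.lift
    ((LinearMap.mul K (Module.End K L)).compl₁₂ (LinearMap.mul K L)
      (Algebra.lsmul K K L : H →ₐ[K] Module.End K L).toLinearMap)

@[simp]
theorem canonicalMap_tmul_apply (s t : L) (h : H) :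
    canonicalMap K H L (s ⊗ₜ[K] h) t = s * (h • t) := by
  simp [canonicalMap]

/-- `L` is an `H`-module algebra: the action of `H` on `L` satisfies `h • 1 = ε(h) 1` and
`h • (a b) = ∑ (h₍₁₎ • a) (h₍₂₎ • b)`, where `Δ(h) = ∑ h₍₁₎ ⊗ h₍₂₎`. -/
structure IsModuleAlgebra : Prop where
  smul_one : ∀ h : H, h • (1 : L) = algebraMap K L (Coalgebra.counit (R := K) h)
  smul_mul : ∀ (h : H) (a b : L),
    h • (a * b) = smulMulSmul K H L a b (Coalgebra.comul (R := K) h)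

/-- The given action of the Hopf algebra `H` on `L` is a Hopf-Galois structure on `L/K`: `L` is an
`H`-module algebra and the canonical map `L ⊗[K] H → End_K(L)` is bijective.
For `L/K` finite this forces `H` to be finite-dimensional of dimension `[L : K]`, and,
`L` being commutative, to be cocommutative, so neither is required separately. -/
structure IsHopfGaloisStructure : Prop extends IsModuleAlgebra K H L where
  bijective_canonicalMap : Function.Bijective (canonicalMap K H L)

end HopfGalois

namespace HopfGalois

section

variable {K H L : Type*} [Field K] [Ring H] [HopfAlgebra K H] [Field L] [Algebra K L]
  [Module H L] [IsScalarTower K H L]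

/-! If `x` generates `L` over `H₁`, an element of `H₂` killing `x` commutes past `H₁`, so it kills
`H₁ • x = L` and vanishes by faithfulness. Hence `h ↦ h • x` is injective on `H₂`, and surjective
since `H₂` and `L` have equal dimension over `K`. The converse is symmetric. -/

/-- The action of a Hopf algebra giving a Hopf-Galois structure is faithful. -/
theorem IsHopfGaloisStructure.eq_zero_of_smul_eq_zero (hH : IsHopfGaloisStructure K H L) {h : H}
    (hh : ∀ y : L, h • y = 0) : h = 0 := by
  have h_tmul : (1 : L) ⊗ₜ[K] h = 0 := by
    refine hH.bijective_canonicalMap.injective (LinearMap.ext fun t => ?_)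
    simp [hh t]
  refine Algebra.TensorProduct.includeRight_injective (R := K) (A := L) (B := H)
    (algebraMap K L).injective ?_
  simpa using h_tmul

/-- A Hopf algebra giving a Hopf-Galois structure on `L/K` has dimension `[L : K]`. -/
theorem IsHopfGaloisStructure.finrank_eq [FiniteDimensional K L]
    (hH : IsHopfGaloisStructure K H L) : Module.finrank K H = Module.finrank K L := by
  have e := (LinearEquiv.ofBijective _ hH.bijective_canonicalMap).finrank_eq
  rw [Module.finrank_tensorProduct, Module.finrank_linearMap] at e
  exact Nat.eq_of_mul_eq_mul_left Module.finrank_pos e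

theorem IsHopfGaloisStructure.finiteDimensional [FiniteDimensional K L]
    (hH : IsHopfGaloisStructure K H L) : FiniteDimensional K H :=
  -- `finrank` is `0` on infinite-dimensional spaces, so a positive value forces finiteness.
  Module.finite_of_finrank_pos (hH.finrank_eq ▸ Module.finrank_pos)

/-- An element on which a Hopf algebra giving a Hopf-Galois structure acts freely generates. -/
theorem IsHopfGaloisStructure.span_singleton_eq_top [FiniteDimensional K L]
    (hH : IsHopfGaloisStructure K H L) {x : L} (hx : ∀ h : H, h • x = 0 → h = 0) :
    Submodule.span H {x} = ⊤ := by
  have := hH.finiteDimensional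
  let f : H →ₗ[K] L := (LinearMap.toSpanSingleton H L x).restrictScalars K
  have hf : Function.Injective f := (injective_iff_map_eq_zero f).2 hx
  have hs : Function.Surjective f :=
    (LinearMap.injective_iff_surjective_of_finrank_eq_finrank hH.finrank_eq).1 hf
  refine Submodule.eq_top_iff'.2 fun y => Submodule.mem_span_singleton.2 ?_
  exact hs y

end

/-- If `x` generates `L` under an action commuting with that of `H`, then `H` acts freely on `x`:
an element of `H` killing `x` kills all of `L`. -/
theorem IsHopfGaloisStructure.span_singleton_eq_top_of_commute {K H A L : Type*} [Field K]
    [Field L] [Algebra K L] [FiniteDimensional K L] [Ring H] [HopfAlgebra K H] [Module H L]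
    [IsScalarTower K H L] [Ring A] [Module A L] (hH : IsHopfGaloisStructure K H L)
    (hcomm : ∀ (a : A) (h : H) (y : L), a • (h • y) = h • (a • y)) {x : L}
    (hx : Submodule.span A {x} = ⊤) : Submodule.span H {x} = ⊤ := by
  refine hH.span_singleton_eq_top fun h h_smul => hH.eq_zero_of_smul_eq_zero fun y => ?_
  -- Write `y = a • x` and move `h` past `a`.
  obtain ⟨a, rfl⟩ := Submodule.mem_span_singleton.1 (hx ▸ Submodule.mem_top : y ∈ _)
  rw [← hcomm, h_smul, smul_zero]

end HopfGalois

theorem theorem1p1 {K L H₁ H₂ : Type*} [Field K] [Field L] [Algebra K L]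
    [FiniteDimensional K L] [Algebra.IsSeparable K L]
    [Ring H₁] [HopfAlgebra K H₁] [Module H₁ L] [IsScalarTower K H₁ L]
    [Ring H₂] [HopfAlgebra K H₂] [Module H₂ L] [IsScalarTower K H₂ L]
    (hH₁ : HopfGalois.IsHopfGaloisStructure K H₁ L)
    (hH₂ : HopfGalois.IsHopfGaloisStructure K H₂ L)
    (hcomm : ∀ (h₁ : H₁) (h₂ : H₂) (y : L), h₁ • (h₂ • y) = h₂ • (h₁ • y))
    (x : L) :
    Submodule.span H₁ {x} = ⊤ ↔ Submodule.span H₂ {x} = ⊤ :=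
  ⟨hH₂.span_singleton_eq_top_of_commute hcomm,
    hH₁.span_singleton_eq_top_of_commute fun h₂ h₁ y => (hcomm h₁ h₂ y).symm⟩
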